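/- Let $\Gamma$ be a finite simple graph with vertex set $V$ and edge set $E$, and let $\Bbbk$ be a nonzero commutative ring. Let $$A_\Gamma=\langle V\mid vw=wv\text{ whenever }\{v,w\}\in E\rangle$$ be the associated right angled Artin group, and define unital associative $\Bbbk$-algebras by generators and relations $$R_\Gamma=\langle V\mid vw=wv\text{ whenever }\{v,w\}\in E\rangle,$$ $$S_\Gamma=\langle V\mid v^2=0,\ vw=-wv\ \text{ for all } v,w\in V,\text{ and } vw=0\text{ whenever }\{v,w\}\notin E\rangle,$$ graded by $\deg v=1$ for $v\in V$. For a graded $\Bbbk$-algebra $R=\bigoplus_{n\ge0}R_n$ all of whose $R_n$ are finitely generated free $\Bbbk$-modules, let $\Phi_R(t)=\sum_{n\ge0}\operatorname{rank}(R_n)t^n$ be its Poincaré series. Let $\Phi_{A_\Gamma}(t)=\sum_{g\in A_\Gamma}t^{|g|}$ be the growth series of $A_\Gamma$, where $|g|$ is the least number of factors from $V\cup V^{-1}$ needed to write $g$ as a product. Let $c_n(\Gamma)$ be the number of cliques of size $n$ in $\Gamma$, that is, of $n$-element sets of pairwise adjacent vertices (so $c_0(\Gamma)=1$). Then all homogeneous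 components of $R_\Gamma$ and $S_\Gamma$ are finitely generated free $\Bbbk$-modules, $A_\Gamma$ has only finitely many elements of each word length, and the following identities of formal power series hold: $$\Phi_{S_\Gamma}(t)=\sum_{n=0}^{|V|}c_n(\Gamma)t^n,\qquad \Phi_{R_\Gamma}(t)\cdot\Phi_{S_\Gamma}(-t)=1,\qquad \Phi_{A_\Gamma}(t)=\Phi_{R_\Gamma}\left(\frac{2t}{1+t}\right).$$ -/

import Mathlib

universe u v

noncomputable section

namespace RAAG

open PowerSeries

/-! ### Growth series of a group with a fixed generating set -/

/-- The word length of `g` with respect to `X`: the least number of factors from `X ∪ X⁻¹`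
needed to write `g` as a product. (If `X` generates the group, every `g` is such a product.) -/
def wordLength {G : Type u} [Group G] (X : Set G) (g : G) : ℕ :=
  sInf {n | ∃ l : List G, (∀ x ∈ l, x ∈ X ∨ x⁻¹ ∈ X) ∧ l.prod = g ∧ l.length = n}

/-- The elements of word length exactly `n`. -/
def wordSphere {G : Type u} [Group G] (X : Set G) (n : ℕ) : Set G :=
  {g | wordLength X g = n}

/-- The growth series `∑_{g ∈ G} t^{|g|}`: the coefficient of `t^n` is the number of elements
of word length `n` (meaningful when `X` generates `G` and all spheres are finite). -/
def growthSeries {G : Type u} [Group G] (X : Set G) : ℚ⟦X⟧ :=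
  PowerSeries.mk fun n => ((wordSphere X n).ncard : ℚ)

/-! ### Poincaré series of a graded algebra -/

/-- The Poincaré series `∑ rank(𝒜 n) t^n` of a graded algebra (meaningful when every `𝒜 n` is a
finitely generated free module). -/
def poincareSeries {k : Type u} {A : Type v} [CommRing k] [Ring A] [Algebra k A]
    (𝒜 : ℕ → Submodule k A) [GradedAlgebra 𝒜] : ℚ⟦X⟧ :=
  PowerSeries.mk fun n => (Module.finrank k (𝒜 n) : ℚ)

/-! ### The right angled Artin group -/

/-- The relators `v w v⁻¹ w⁻¹` for `{v, w}` an edge. -/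
def groupRels {V : Type v} (Γ : SimpleGraph V) : Set (FreeGroup V) :=
  {r | ∃ a b : V, Γ.Adj a b ∧
    r = FreeGroup.of a * FreeGroup.of b * (FreeGroup.of a)⁻¹ * (FreeGroup.of b)⁻¹}

/-- The right angled Artin group `A_Γ = ⟨V ∣ v w = w v whenever {v, w} ∈ E⟩`. -/
abbrev ArtinGroup {V : Type v} (Γ : SimpleGraph V) : Type v :=
  PresentedGroup (groupRels Γ)

/-- The standard generating set of `A_Γ`, the image of `V`. -/
def artinGens {V : Type v} (Γ : SimpleGraph V) : Set (ArtinGroup Γ) :=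
  Set.range (PresentedGroup.of : V → ArtinGroup Γ)

theorem closure_artinGens {V : Type v} (Γ : SimpleGraph V) :
    Subgroup.closure (artinGens Γ) = ⊤ :=
  PresentedGroup.closure_range_of _

/-! ### The algebra `R_Γ` of polynomials in partially commuting variables -/

/-- The relations `v w = w v` for `{v, w}` an edge. -/
inductive PolyRel (k : Type u) {V : Type v} [CommRing k] (Γ : SimpleGraph V) :
    FreeAlgebra k V → FreeAlgebra k V → Prop
  | comm (a b : V) (h : Γ.Adj a b) :
      PolyRel k Γ (FreeAlgebra.ι k a * FreeAlgebra.ι k b) (FreeAlgebra.ι k b * FreeAlgebra.ι k a)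

/-- `R_Γ`, the unital associative `k`-algebra `⟨V ∣ v w = w v whenever {v, w} ∈ E⟩`. -/
abbrev PolyAlg (k : Type u) {V : Type v} [CommRing k] (Γ : SimpleGraph V) : Type (max u v) :=
  RingQuot (PolyRel k Γ)

/-- The generator of `R_Γ` attached to a vertex. -/
def polyGen (k : Type u) {V : Type v} [CommRing k] (Γ : SimpleGraph V) (a : V) : PolyAlg k Γ :=
  RingQuot.mkAlgHom k (PolyRel k Γ) (FreeAlgebra.ι k a)

/-- The degree `n` part of `R_Γ` for `deg v = 1`: the span of the products of `n` generators. -/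
def polyGrading (k : Type u) {V : Type v} [CommRing k] (Γ : SimpleGraph V) (n : ℕ) :
    Submodule k (PolyAlg k Γ) :=
  Submodule.span k (Set.range (polyGen k Γ)) ^ n

/-! ### The algebra `S_Γ`, the exterior algebra in partially commuting variables -/

/-- The relations `v² = 0`, `v w = - w v` for all `v, w`, and `v w = 0` whenever `{v, w}` is not
an edge. -/
inductive ExtRel (k : Type u) {V : Type v} [CommRing k] (Γ : SimpleGraph V) :
    FreeAlgebra k V → FreeAlgebra k V → Prop
  | sq (a : V) : ExtRel k Γ (FreeAlgebra.ι k a * FreeAlgebra.ι k a) 0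
  | anticomm (a b : V) :
      ExtRel k Γ (FreeAlgebra.ι k a * FreeAlgebra.ι k b)
        (-(FreeAlgebra.ι k b * FreeAlgebra.ι k a))
  | nonadj (a b : V) (h : ¬ Γ.Adj a b) :
      ExtRel k Γ (FreeAlgebra.ι k a * FreeAlgebra.ι k b) 0

/-- `S_Γ`, the unital associative `k`-algebra
`⟨V ∣ v² = 0, v w = - w v for all v, w, and v w = 0 whenever {v, w} ∉ E⟩`. -/
abbrev ExtAlg (k : Type u) {V : Type v} [CommRing k] (Γ : SimpleGraph V) : Type (max u v) :=
  RingQuot (ExtRel k Γ)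

/-- The generator of `S_Γ` attached to a vertex. -/
def extGen (k : Type u) {V : Type v} [CommRing k] (Γ : SimpleGraph V) (a : V) : ExtAlg k Γ :=
  RingQuot.mkAlgHom k (ExtRel k Γ) (FreeAlgebra.ι k a)

/-- The degree `n` part of `S_Γ` for `deg v = 1`: the span of the products of `n` generators. -/
def extGrading (k : Type u) {V : Type v} [CommRing k] (Γ : SimpleGraph V) (n : ℕ) :
    Submodule k (ExtAlg k Γ) :=
  Submodule.span k (Set.range (extGen k Γ)) ^ n

/-! ### `R_Γ` and `S_Γ` are graded algebras -/

instance polyGradedMonoid (k : Type u) {V : Type v} [CommRing k] (Γ : SimpleGraph V) :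
    SetLike.GradedMonoid (polyGrading k Γ) :=
  Submodule.nat_power_gradedMonoid _

instance extGradedMonoid (k : Type u) {V : Type v} [CommRing k] (Γ : SimpleGraph V) :
    SetLike.GradedMonoid (extGrading k Γ) :=
  Submodule.nat_power_gradedMonoid _

theorem polyGen_mem (k : Type u) {V : Type v} [CommRing k] (Γ : SimpleGraph V) (a : V) :
    polyGen k Γ a ∈ polyGrading k Γ 1 := by
  rw [polyGrading, pow_one]
  exact Submodule.subset_span ⟨a, rfl⟩

theorem extGen_mem (k : Type u) {V : Type v} [CommRing k] (Γ : SimpleGraph V) (a : V) :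
    extGen k Γ a ∈ extGrading k Γ 1 := by
  rw [extGrading, pow_one]
  exact Submodule.subset_span ⟨a, rfl⟩

theorem polyGen_comm (k : Type u) {V : Type v} [CommRing k] (Γ : SimpleGraph V) (a b : V)
    (h : Γ.Adj a b) : polyGen k Γ a * polyGen k Γ b = polyGen k Γ b * polyGen k Γ a := by
  simpa only [polyGen, map_mul] using RingQuot.mkAlgHom_rel k (PolyRel.comm (k := k) a b h)

theorem extGen_anticomm (k : Type u) {V : Type v} [CommRing k] (Γ : SimpleGraph V) (a b : V) :
    extGen k Γ a * extGen k Γ b = -(extGen k Γ b * extGen k Γ a) := by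
  simpa only [extGen, map_mul, map_neg] using
    RingQuot.mkAlgHom_rel k (ExtRel.anticomm (k := k) (Γ := Γ) a b)

theorem extGen_nonadj (k : Type u) {V : Type v} [CommRing k] (Γ : SimpleGraph V) (a b : V)
    (h : ¬ Γ.Adj a b) : extGen k Γ a * extGen k Γ b = 0 := by
  simpa only [extGen, map_mul, map_zero] using
    RingQuot.mkAlgHom_rel k (ExtRel.nonadj (k := k) a b h)

/-- The algebra map `R_Γ → ⨁ n, (R_Γ)_n` sending a generator to itself in degree one. -/
def polyDecompose (k : Type u) {V : Type v} [CommRing k] (Γ : SimpleGraph V) :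
    PolyAlg k Γ →ₐ[k] DirectSum ℕ (fun n => polyGrading k Γ n) :=
  RingQuot.liftAlgHom k ⟨FreeAlgebra.lift k fun a =>
    DirectSum.of (fun n => polyGrading k Γ n) 1 ⟨polyGen k Γ a, polyGen_mem k Γ a⟩, by
      rintro _ _ ⟨a, b, h⟩
      simp only [map_mul, FreeAlgebra.lift_ι_apply, DirectSum.of_mul_of]
      congr 1
      exact Subtype.ext (polyGen_comm k Γ a b h)⟩

/-- The algebra map `S_Γ → ⨁ n, (S_Γ)_n` sending a generator to itself in degree one. -/
def extDecompose (k : Type u) {V : Type v} [CommRing k] (Γ : SimpleGraph V) :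
    ExtAlg k Γ →ₐ[k] DirectSum ℕ (fun n => extGrading k Γ n) :=
  RingQuot.liftAlgHom k ⟨FreeAlgebra.lift k fun a =>
    DirectSum.of (fun n => extGrading k Γ n) 1 ⟨extGen k Γ a, extGen_mem k Γ a⟩, by
      have key : ∀ a b : V, ¬ Γ.Adj a b →
          DirectSum.of (fun n => extGrading k Γ n) 1 ⟨extGen k Γ a, extGen_mem k Γ a⟩ *
          DirectSum.of (fun n => extGrading k Γ n) 1 ⟨extGen k Γ b, extGen_mem k Γ b⟩ = 0 := by
        intro a b h
        rw [DirectSum.of_mul_of]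
        refine (congrArg _ (Subtype.ext ?_)).trans (map_zero _)
        exact extGen_nonadj k Γ a b h
      rintro _ _ (⟨a⟩ | ⟨a, b⟩ | ⟨a, b, h⟩)
      · simp only [map_mul, FreeAlgebra.lift_ι_apply, map_zero]
        exact key a a (Γ.irrefl)
      · rw [← neg_one_smul k, map_smul]
        simp only [map_mul, FreeAlgebra.lift_ι_apply, DirectSum.of_mul_of]
        refine Eq.trans ?_ (map_smul (DirectSum.lof k ℕ (fun n => extGrading k Γ n) (1 + 1)) (-1 : k) _)
        refine congrArg _ (Subtype.ext ?_)
        exact (extGen_anticomm k Γ a b).trans (neg_one_smul k _).symm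
      · simp only [map_mul, FreeAlgebra.lift_ι_apply, map_zero]
        exact key a b h⟩

theorem polyDecompose_gen (k : Type u) {V : Type v} [CommRing k] (Γ : SimpleGraph V) (a : V) :
    polyDecompose k Γ (polyGen k Γ a) =
      DirectSum.of (fun n => polyGrading k Γ n) 1 ⟨polyGen k Γ a, polyGen_mem k Γ a⟩ := by
  exact (RingQuot.liftAlgHom_mkAlgHom_apply _ _ _ _).trans (FreeAlgebra.lift_ι_apply _ _)

theorem extDecompose_gen (k : Type u) {V : Type v} [CommRing k] (Γ : SimpleGraph V) (a : V) :
    extDecompose k Γ (extGen k Γ a) =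
      DirectSum.of (fun n => extGrading k Γ n) 1 ⟨extGen k Γ a, extGen_mem k Γ a⟩ := by
  exact (RingQuot.liftAlgHom_mkAlgHom_apply _ _ _ _).trans (FreeAlgebra.lift_ι_apply _ _)

/-- If an algebra map `f` sends `g a` to itself in degree one, then it sends every element of
degree `n` (a combination of products of `n` of the `g a`) to itself in degree `n`. -/
theorem decompose_mem {k : Type u} {V A : Type*} [CommRing k] [Ring A] [Algebra k A] (g : V → A)
    (𝒜 : ℕ → Submodule k A) [SetLike.GradedMonoid 𝒜]
    (h𝒜 : ∀ n, 𝒜 n = Submodule.span k (Set.range g) ^ n)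
    (f : A →ₐ[k] DirectSum ℕ (fun n => 𝒜 n)) (hg : ∀ a, g a ∈ 𝒜 1)
    (hf : ∀ a, f (g a) = DirectSum.of (fun n => 𝒜 n) 1 ⟨g a, hg a⟩) (n : ℕ) (x : A)
    (hx : x ∈ 𝒜 n) : f x = DirectSum.of (fun n => 𝒜 n) n ⟨x, hx⟩ := by
  have h1 : ∀ (y : A) (hy : y ∈ 𝒜 1), f y = DirectSum.of (fun n => 𝒜 n) 1 ⟨y, hy⟩ := by
    intro y hy
    have hy' : y ∈ Submodule.span k (Set.range g) := by simpa [h𝒜] using hy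
    induction hy' using Submodule.span_induction with
    | mem y h => obtain ⟨a, rfl⟩ := h; exact hf a
    | zero =>
      rw [map_zero]
      exact (map_zero (DirectSum.of (fun n => 𝒜 n) 1)).symm
    | add y z hys hzs ihy ihz =>
      have hy1 : y ∈ 𝒜 1 := by simpa [h𝒜] using hys
      have hz1 : z ∈ 𝒜 1 := by simpa [h𝒜] using hzs
      rw [map_add, ihy hy1, ihz hz1, ← map_add]
      rfl
    | smul r y hys ihy =>
      have hy1 : y ∈ 𝒜 1 := by simpa [h𝒜] using hys
      rw [map_smul, ihy hy1]
      exact (map_smul (DirectSum.lof k ℕ (fun n => 𝒜 n) 1) r ⟨y, hy1⟩).symm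
  have hx' : x ∈ Submodule.span k (Set.range g) ^ n := by rw [← h𝒜]; exact hx
  induction hx' using Submodule.pow_induction_on_left' with
  | algebraMap r =>
    rw [AlgHom.commutes, DirectSum.algebraMap_apply]
    rfl
  | add y z i hy hz ihy ihz =>
    rw [← h𝒜] at hy hz
    rw [map_add, ihy hy, ihz hz, ← map_add]
    rfl
  | mem_mul m hm i y hy ih =>
    have hm1 : m ∈ 𝒜 1 := by rw [h𝒜, pow_one]; exact hm
    rw [← h𝒜] at hy
    rw [map_mul, h1 m hm1, ih hy, DirectSum.of_mul_of]
    exact DirectSum.of_eq_of_gradedMonoid_eq (Sigma.subtype_ext (add_comm _ _) rfl)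

instance polyGradedAlgebra (k : Type u) {V : Type v} [CommRing k] (Γ : SimpleGraph V) :
    GradedAlgebra (polyGrading k Γ) :=
  GradedAlgebra.ofAlgHom (polyGrading k Γ) (polyDecompose k Γ)
    (by
      apply RingQuot.ringQuot_ext'
      ext a
      change DirectSum.coeAlgHom (polyGrading k Γ) (polyDecompose k Γ (polyGen k Γ a)) =
        polyGen k Γ a
      rw [polyDecompose_gen]
      exact DirectSum.coeAlgHom_of _ _ _)
    (fun n x => decompose_mem (polyGen k Γ) (polyGrading k Γ) (fun _ => rfl) (polyDecompose k Γ)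
      (polyGen_mem k Γ) (polyDecompose_gen k Γ) n x x.2)

instance extGradedAlgebra (k : Type u) {V : Type v} [CommRing k] (Γ : SimpleGraph V) :
    GradedAlgebra (extGrading k Γ) :=
  GradedAlgebra.ofAlgHom (extGrading k Γ) (extDecompose k Γ)
    (by
      apply RingQuot.ringQuot_ext'
      ext a
      change DirectSum.coeAlgHom (extGrading k Γ) (extDecompose k Γ (extGen k Γ a)) =
        extGen k Γ a
      rw [extDecompose_gen]
      exact DirectSum.coeAlgHom_of _ _ _)
    (fun n x => decompose_mem (extGen k Γ) (extGrading k Γ) (fun _ => rfl) (extDecompose k Γ)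
      (extGen_mem k Γ) (extDecompose_gen k Γ) n x x.2)

end RAAG

end

noncomputable section

namespace RAAG

open PowerSeries

/-! ### Traces: words up to commutation of adjacent letters -/

/-! All three series count combinatorial objects. `R_Γ` has the traces as a basis, `S_Γ` the
cliques, and `A_Γ` is in bijection with the traces in signed letters in which nothing cancels. Each
claim is proved by an action: the algebra or group acts on the free module on the candidates, or on
their set, and the orbit map of the empty object inverts the evaluation map
(`free_finrank_of_action`, `artinEquiv`).

The identities then come from one inclusion-exclusion, `sum_clique_mul_divSeries`. The possible
first letters of a trace form a clique, empty only for the empty trace, so the sum of `(-1)^|C|`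
over the cliques `C` inside it is `1` for the empty trace and `0` otherwise. If requiring one more
vertex among the first letters always multiplies the counting series by `q`, it follows that (clique
polynomial at `-q`) · (total series) = 1.

For traces `q = t`. For reduced traces a vertex carries two letters, and a letter may be prepended
only if its inverse is not a first letter; this gives `(1 + t) q = 2t`. Substituting `2t/(1+t)` in
the first identity and comparing with the second yields the growth series of `A_Γ`. -/

/-- Two words are equivalent if they differ by exchanging neighbouring letters that are adjacent
in the graph. -/
inductive TraceRel {S : Type v} (Γ : SimpleGraph S) : List S → List S → Prop
  | refl (l : List S) : TraceRel Γ l l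
  | cons (a : S) {l l' : List S} (h : TraceRel Γ l l') : TraceRel Γ (a :: l) (a :: l')
  | swap (a b : S) (l : List S) (h : Γ.Adj a b) : TraceRel Γ (a :: b :: l) (b :: a :: l)
  | trans {l l' l'' : List S} (h : TraceRel Γ l l') (h' : TraceRel Γ l' l'') : TraceRel Γ l l''

theorem TraceRel.symm {S : Type v} {Γ : SimpleGraph S} {l l' : List S} (h : TraceRel Γ l l') :
    TraceRel Γ l' l := by
  induction h with
  | refl l => exact .refl l
  | cons a _ ih => exact .cons a ih
  | swap a b l h => exact .swap b a l h.symm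
  | trans _ _ ih ih' => exact .trans ih' ih

/-- The setoid of words up to commutation. -/
def traceSetoid {S : Type v} (Γ : SimpleGraph S) : Setoid (List S) where
  r := TraceRel Γ
  iseqv := ⟨.refl, .symm, .trans⟩

/-- Traces: words up to commutation of adjacent letters. -/
def Trace {S : Type v} (Γ : SimpleGraph S) : Type v := Quotient (traceSetoid Γ)

namespace Trace

variable {S : Type v} {Γ : SimpleGraph S}

/-- The trace of a word. -/
def mk (Γ : SimpleGraph S) (l : List S) : Trace Γ := Quotient.mk (traceSetoid Γ) l

theorem mk_eq {l l' : List S} (h : TraceRel Γ l l') : mk Γ l = mk Γ l' :=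
  Quotient.sound (s := traceSetoid Γ) h

/-- Multiplication by a letter on the left. -/
def cons (a : S) : Trace Γ → Trace Γ :=
  Quotient.lift (fun l => mk Γ (a :: l)) fun _ _ h => mk_eq (.cons a h)

/-- The empty trace. -/
def nil : Trace Γ := mk Γ []

theorem cons_mk (a : S) (l : List S) : cons a (mk Γ l) = mk Γ (a :: l) := rfl

@[elab_as_elim]
theorem ind {p : Trace Γ → Prop} (nil : p nil) (cons : ∀ a m, p m → p (cons a m))
    (m : Trace Γ) : p m := by
  obtain ⟨l, rfl⟩ := Quotient.exists_rep m
  induction l with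
  | nil => exact nil
  | cons a l ih => exact cons a _ ih

theorem cons_comm {a b : S} (h : Γ.Adj a b) (m : Trace Γ) :
    cons a (cons b m) = cons b (cons a m) := by
  obtain ⟨l, rfl⟩ := Quotient.exists_rep m
  exact mk_eq (.swap a b l h)

/-- The number of letters of a trace. -/
def length : Trace Γ → ℕ :=
  Quotient.lift List.length fun _ _ h => by
    induction h with
    | refl => rfl
    | cons a _ ih => simp [ih]
    | swap a b l _ => simp
    | trans _ _ ih ih' => exact ih.trans ih'

theorem length_nil : (nil : Trace Γ).length = 0 := rfl

theorem length_cons (a : S) (m : Trace Γ) : (cons a m).length = m.length + 1 := by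
  obtain ⟨l, rfl⟩ := Quotient.exists_rep m
  rfl

theorem finite_length [Finite S] (n : ℕ) : {m : Trace Γ | m.length = n}.Finite := by
  refine ((List.finite_length_eq S n).image (mk Γ)).subset fun m hm => ?_
  obtain ⟨l, rfl⟩ := Quotient.exists_rep m
  exact ⟨l, hm, rfl⟩

/-- The product of the values of the letters of a trace, for a map under which adjacent letters
commute. -/
def prod {M : Type*} [Monoid M] (f : S → M) (hf : ∀ a b, Γ.Adj a b → f a * f b = f b * f a) :
    Trace Γ → M :=
  Quotient.lift (fun l => (l.map f).prod) fun _ _ h => by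
    induction h with
    | refl => rfl
    | cons a _ ih => simpa using congrArg (f a * ·) ih
    | swap a b l h => simp [← mul_assoc, hf a b h]
    | trans _ _ ih ih' => exact ih.trans ih'

section prod
variable {M : Type*} [Monoid M] (f : S → M) (hf : ∀ a b, Γ.Adj a b → f a * f b = f b * f a)

theorem prod_nil : prod f hf nil = 1 := rfl

theorem prod_cons (a : S) (m : Trace Γ) : prod f hf (cons a m) = f a * prod f hf m := by
  obtain ⟨l, rfl⟩ := Quotient.exists_rep m
  exact List.prod_cons
end prod

/-! ### Left division and the possible first letters of a trace -/

open Classical in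
/-- Left division of a word by a letter. -/
def popList (Γ : SimpleGraph S) (a : S) : List S → Option (Trace Γ)
  | [] => none
  | b :: l => if a = b then some (mk Γ l) else
      if Γ.Adj a b then (popList Γ a l).map (cons b) else none

/-- Left division by a letter: `pop a m = some m'` if and only if `m = cons a m'`. -/
def pop (a : S) : Trace Γ → Option (Trace Γ) :=
  Quotient.lift (popList Γ a) fun _ _ h => by
    induction h with
    | refl => rfl
    | @cons b l l' h ih =>
      simp only [popList, ih, mk_eq h]
    | swap b c l h =>
      have hbc := h.ne
      simp only [popList]
      by_cases hb : a = b
      · subst hb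
        simp [hbc, h, cons_mk]
      · by_cases hc : a = c
        · subst hc
          simp [hb, h.symm, cons_mk]
        · by_cases hb' : Γ.Adj a b <;> by_cases hc' : Γ.Adj a c <;>
            simp [hb, hc, hb', hc', Function.comp_def, cons_comm h]
    | trans _ _ ih ih' => exact ih.trans ih'

theorem pop_nil (a : S) : pop a (nil : Trace Γ) = none := rfl

theorem pop_cons_self (a : S) (m : Trace Γ) : pop a (cons a m) = some m := by
  obtain ⟨l, rfl⟩ := Quotient.exists_rep m
  exact if_pos rfl

theorem pop_cons_of_adj {a b : S} (h : Γ.Adj a b) (m : Trace Γ) :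
    pop a (cons b m) = (pop a m).map (cons b) := by
  obtain ⟨l, rfl⟩ := Quotient.exists_rep m
  exact (if_neg h.ne).trans (if_pos h)

theorem pop_cons_of_not_adj {a b : S} (h : a ≠ b) (h' : ¬ Γ.Adj a b) (m : Trace Γ) :
    pop a (cons b m) = none := by
  obtain ⟨l, rfl⟩ := Quotient.exists_rep m
  exact (if_neg h).trans (if_neg h')

theorem eq_cons_of_pop {a : S} {m m' : Trace Γ} (h : pop a m = some m') : m = cons a m' := by
  induction m using ind generalizing m' with
  | nil => simp [pop_nil] at h
  | cons b m ih =>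
    by_cases hab : a = b
    · subst hab
      rw [pop_cons_self, Option.some_inj] at h
      rw [h]
    · by_cases hadj : Γ.Adj a b
      · rw [pop_cons_of_adj hadj, Option.map_eq_some_iff] at h
        obtain ⟨m'', h, rfl⟩ := h
        rw [ih h, cons_comm hadj]
      · rw [pop_cons_of_not_adj hab hadj] at h
        cases h

theorem cons_injective (a : S) : Function.Injective (cons a : Trace Γ → Trace Γ) := by
  intro m m' h
  simpa [pop_cons_self] using congrArg (pop a) h

theorem eq_nil_of_pop {m : Trace Γ} (h : ∀ a, pop a m = none) : m = nil := by
  induction m using ind with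
  | nil => rfl
  | cons a m _ => exact absurd (h a) (by simp [pop_cons_self])

/-- Two different possible first letters of a trace are adjacent. -/
theorem adj_of_pop {a b : S} (h : a ≠ b) {m : Trace Γ} (ha : pop a m ≠ none)
    (hb : pop b m ≠ none) : Γ.Adj a b := by
  obtain ⟨m', hm'⟩ := Option.ne_none_iff_exists'.1 hb
  by_contra hab
  -- With `m = b m'`, the letter `a` could reach the front only by passing `b`.
  rw [eq_cons_of_pop hm', pop_cons_of_not_adj h hab] at ha
  exact ha rfl

theorem pop_cons_ne_none_iff {a b : S} (h : Γ.Adj a b) (m : Trace Γ) :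
    pop a (cons b m) ≠ none ↔ pop a m ≠ none := by
  simp [pop_cons_of_adj h]

end Trace

/-! ### Algebras acting on a free module with a graded basis -/

/-- If an algebra generated by the `g a` acts on a free module with graded basis such that the
orbit map of a basis vector of degree `0` has a graded inverse, then its graded pieces are free,
with ranks the numbers of basis elements of the given degree. -/
theorem free_finrank_of_action {k : Type*} {V A I : Type*} [CommRing k] [Nontrivial k] [Ring A]
    [Algebra k A] (g : V → A) (hg : Algebra.adjoin k (Set.range g) = ⊤) (deg : I → ℕ) (e : I)
    (he : deg e = 0) (T : A →ₐ[k] Module.End k (I →₀ k)) (b : I → A) (hbe : b e = 1)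
    (hTb : ∀ a i, Finsupp.linearCombination k b (T (g a) (Finsupp.single i 1)) = g a * b i)
    (hbT : ∀ i, T (b i) (Finsupp.single e 1) = Finsupp.single i 1)
    (hdeg : ∀ a i, T (g a) (Finsupp.single i 1) ∈ Finsupp.supported k k {j | deg j = deg i + 1})
    (hbdeg : ∀ i, b i ∈ Submodule.span k (Set.range g) ^ deg i) (n : ℕ)
    (hfin : {i | deg i = n}.Finite) :
    Module.Free k ↥(Submodule.span k (Set.range g) ^ n) ∧
    Module.Finite k ↥(Submodule.span k (Set.range g) ^ n) ∧
    Module.finrank k ↥(Submodule.span k (Set.range g) ^ n) = {i | deg i = n}.ncard := by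
  -- The evaluation map is `A`-linear: it intertwines `T` with left multiplication, which need only
  -- be checked on generators.
  have hmul : ∀ x y, Finsupp.linearCombination k b (T x y) =
      x * Finsupp.linearCombination k b y := by
    intro x
    have hx : x ∈ Algebra.adjoin k (Set.range g) := hg ▸ Algebra.mem_top
    induction hx using Algebra.adjoin_induction with
    | mem x hx =>
      obtain ⟨a, rfl⟩ := hx
      intro y
      have : Finsupp.linearCombination k b ∘ₗ T (g a) =
          LinearMap.mulLeft k (g a) ∘ₗ Finsupp.linearCombination k b := by
        ext i
        simp [hTb]
      exact LinearMap.congr_fun this y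
    | algebraMap r => intro y; simp [Algebra.smul_def, Module.algebraMap_end_apply]
    | add x x' _ _ h h' => intro y; simp [h, h', add_mul]
    | mul x x' _ _ h h' => intro y; simp [h, h', mul_assoc]
  let φ : A →ₗ[k] (I →₀ k) := (LinearMap.applyₗ (Finsupp.single e 1)) ∘ₗ T.toLinearMap
  have hφ : ∀ x, φ x = T x (Finsupp.single e 1) := fun _ => rfl
  -- The orbit map of `e` inverts evaluation: one composite is `hbT`, the other is `hmul` at the
  -- basis vector `e`. Spanning and independence of the `b i` come together.
  let E : A ≃ₗ[k] (I →₀ k) := LinearEquiv.ofLinearMap φ (Finsupp.linearCombination k b)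
    (by ext i : 2; simp [hφ, hbT]) (by ext x; simp [hφ, hmul, hbe])
  have hE : ∀ x, E x = T x (Finsupp.single e 1) := fun _ => rfl
  have hsub : ∀ x ∈ Submodule.span k (Set.range g) ^ n,
      E x ∈ Finsupp.supported k k {j | deg j = n} := by
    intro x hx
    clear hfin
    induction hx using Submodule.pow_induction_on_left' with
    | algebraMap r =>
      rw [hE, AlgHom.commutes, Module.algebraMap_end_apply]
      exact Submodule.smul_mem _ _ (Finsupp.single_mem_supported _ _ he)
    | add x y i _ _ hx hy => rw [map_add]; exact Submodule.add_mem _ hx hy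
    | mem_mul m hm i x _ ih =>
      rw [hE, map_mul, Module.End.mul_apply, ← hE]
      have key : Finsupp.supported k k {j | deg j = i} ≤
          (Finsupp.supported k k {j | deg j = i + 1}).comap (T m) := by
        rw [Finsupp.supported_eq_span_single, Submodule.span_le]
        rintro _ ⟨j, hj, rfl⟩
        have hj : deg j = i := hj
        -- For a fixed basis vector `j` the condition is linear in `m`, so it reduces to the
        -- generators.
        have : Submodule.span k (Set.range g) ≤ (Finsupp.supported k k {j | deg j = i + 1}).comap
            ((LinearMap.applyₗ (Finsupp.single j 1)) ∘ₗ T.toLinearMap) := by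
          rw [Submodule.span_le]
          rintro _ ⟨a, rfl⟩
          exact hj ▸ hdeg a j
        exact this hm
      exact key ih
  have hmap : (Submodule.span k (Set.range g) ^ n).map (E : A →ₗ[k] (I →₀ k)) =
      Finsupp.supported k k {j | deg j = n} := by
    refine le_antisymm (Submodule.map_le_iff_le_comap.2 hsub) ?_
    rw [Finsupp.supported_eq_span_single, Submodule.span_le]
    rintro _ ⟨j, hj, rfl⟩
    have hj : deg j = n := hj
    exact ⟨b j, hj ▸ hbdeg j, hbT j⟩
  let F : ↥(Submodule.span k (Set.range g) ^ n) ≃ₗ[k] ({j | deg j = n} →₀ k) :=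
    (E.submoduleMap _).trans ((LinearEquiv.ofEq _ _ hmap).trans (Finsupp.supportedEquivFinsupp _))
  have := hfin.to_subtype
  refine ⟨Module.Free.of_equiv F.symm, Module.Finite.equiv F.symm, ?_⟩
  have := hfin.fintype
  rw [F.finrank_eq, Module.finrank_finsupp_self, Set.ncard_eq_toFinset_card', Set.toFinset_card]

theorem adjoin_range_mkAlgHom (k : Type u) {V : Type v} [CommRing k]
    (r : FreeAlgebra k V → FreeAlgebra k V → Prop) :
    Algebra.adjoin k (Set.range fun a => RingQuot.mkAlgHom k r (FreeAlgebra.ι k a)) = ⊤ := by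
  rw [Set.range_comp' (RingQuot.mkAlgHom k r) (FreeAlgebra.ι k), ← AlgHom.map_adjoin,
    FreeAlgebra.adjoin_range_ι, Algebra.map_top, AlgHom.range_eq_top]
  exact RingQuot.mkAlgHom_surjective k r

/-! ### The basis of `R_Γ` given by the traces -/

section poly
variable (k : Type u) {V : Type v} [CommRing k] (Γ : SimpleGraph V)

/-- The action of `R_Γ` on the free module on the traces. -/
def polyAction : PolyAlg k Γ →ₐ[k] Module.End k (Trace Γ →₀ k) :=
  RingQuot.liftAlgHom k ⟨FreeAlgebra.lift k fun a => Finsupp.lmapDomain k k (Trace.cons a), by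
    rintro _ _ ⟨a, b, h⟩
    simp only [map_mul, FreeAlgebra.lift_ι_apply]
    ext m : 2
    simp [Trace.cons_comm h]⟩

theorem polyAction_gen (a : V) (m : Trace Γ) :
    polyAction k Γ (polyGen k Γ a) (Finsupp.single m 1) = Finsupp.single (Trace.cons a m) 1 := by
  have : polyAction k Γ (polyGen k Γ a) = Finsupp.lmapDomain k k (Trace.cons a) :=
    (RingQuot.liftAlgHom_mkAlgHom_apply _ _ _ _).trans (FreeAlgebra.lift_ι_apply _ _)
  simp [this]

theorem polyGrading_free_finrank [Nontrivial k] [Finite V] (n : ℕ) :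
    Module.Free k (polyGrading k Γ n) ∧ Module.Finite k (polyGrading k Γ n) ∧
      Module.finrank k (polyGrading k Γ n) = {m : Trace Γ | m.length = n}.ncard := by
  refine free_finrank_of_action (polyGen k Γ) (adjoin_range_mkAlgHom k _) Trace.length Trace.nil
    Trace.length_nil (polyAction k Γ) (Trace.prod (polyGen k Γ) (polyGen_comm k Γ))
    (Trace.prod_nil _ _) (fun a m => ?_) (fun m => ?_) (fun a m => ?_) (fun m => ?_) n
    (Trace.finite_length n)
  · rw [polyAction_gen, Finsupp.linearCombination_single, one_smul, Trace.prod_cons]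
  · induction m using Trace.ind with
    | nil => simp [Trace.prod_nil]
    | cons a m ih => rw [Trace.prod_cons, map_mul, Module.End.mul_apply, ih, polyAction_gen]
  · rw [polyAction_gen]
    exact Finsupp.single_mem_supported _ _ (Trace.length_cons a m)
  · induction m using Trace.ind with
    | nil => simp [Trace.prod_nil, Trace.length_nil, Submodule.one_le.1 le_rfl]
    | cons a m ih =>
      rw [Trace.prod_cons, Trace.length_cons, pow_succ']
      exact Submodule.mul_mem_mul (Submodule.subset_span ⟨a, rfl⟩) ih

end poly

/-! ### The basis of `S_Γ` given by the cliques -/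

theorem extGen_mul_extGen_mul (k : Type u) {V : Type v} [CommRing k] (Γ : SimpleGraph V)
    (a b : V) (x : ExtAlg k Γ) :
    extGen k Γ a * (extGen k Γ b * x) = (-1 : k) • (extGen k Γ b * (extGen k Γ a * x)) := by
  have h : extGen k Γ a * extGen k Γ b = (-1 : k) • (extGen k Γ b * extGen k Γ a) :=
    (extGen_anticomm k Γ a b).trans (neg_one_smul k _).symm
  rw [← mul_assoc, h, smul_mul_assoc, mul_assoc]

section ext
variable (k : Type u) {V : Type v} [CommRing k] [LinearOrder V] (Γ : SimpleGraph V)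

/-- The finite cliques of a graph. -/
abbrev Clique {V : Type v} (Γ : SimpleGraph V) : Type v := {s : Finset V // Γ.IsClique (s : Set V)}

/-- The sign arising from moving `a` to its place in an ordered product. -/
def moveSign (a : V) (s : Finset V) : k := (-1) ^ (s.filter (· < a)).card

variable {Γ} in
/-- A clique, extended by a vertex adjacent to all its members. -/
def Clique.insert (a : V) (s : Clique Γ) (h : ∀ u ∈ s.1, Γ.Adj a u) : Clique Γ :=
  ⟨Insert.insert a s.1, by
    rw [Finset.coe_insert, SimpleGraph.isClique_insert]
    exact ⟨s.2, fun u hu _ => h u hu⟩⟩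

open Classical in
/-- The value of a vertex on a basis vector of the free module on the cliques. -/
def extStep (a : V) (s : Clique Γ) : Clique Γ →₀ k :=
  if h : ∀ u ∈ s.1, Γ.Adj a u then Finsupp.single (s.insert a h) (moveSign k a s.1) else 0

theorem extStep_of_adj {a : V} {s : Clique Γ} (h : ∀ u ∈ s.1, Γ.Adj a u) :
    extStep k Γ a s = Finsupp.single (s.insert a h) (moveSign k a s.1) := dif_pos h

theorem extStep_of_not_adj {a u : V} {s : Clique Γ} (hu : u ∈ s.1) (h : ¬ Γ.Adj a u) :
    extStep k Γ a s = 0 := dif_neg fun h' => h (h' u hu)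

/-- The action of a vertex on the free module on the cliques. -/
def extOp (a : V) : Module.End k (Clique Γ →₀ k) := Finsupp.linearCombination k (extStep k Γ a)

theorem extOp_single (a : V) (s : Clique Γ) (r : k) :
    extOp k Γ a (Finsupp.single s r) = r • extStep k Γ a s :=
  Finsupp.linearCombination_single _ _ _

/-- Once `b` has acted, the clique contains `b`, which obstructs inserting `a`. The case `a = b`
yields the relation `v² = 0`. -/
theorem extOp_mul_of_not_adj {a b : V} (h : ¬ Γ.Adj a b) : extOp k Γ a * extOp k Γ b = 0 := by
  ext s : 2
  by_cases hs : ∀ u ∈ s.1, Γ.Adj b u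
  · simp [extOp_single, extStep_of_adj k Γ hs,
      extStep_of_not_adj k Γ (s := s.insert b hs) (Finset.mem_insert_self b s.1) h]
  · push Not at hs
    obtain ⟨u, hu, hbu⟩ := hs
    simp [extOp_single, extStep_of_not_adj k Γ hu hbu]

theorem moveSign_insert_of_lt {a b : V} (h : b < a) {s : Finset V} (hb : b ∉ s) :
    moveSign k a (insert b s) = -moveSign k a s := by
  simp [moveSign, Finset.filter_insert, h, hb, pow_succ]

theorem moveSign_insert_of_gt {a b : V} (h : a < b) (s : Finset V) :
    moveSign k a (insert b s) = moveSign k a s := by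
  simp [moveSign, Finset.filter_insert, h.not_gt]

/-- Exactly one of `a`, `b` is the smaller, so inserting the other vertex flips exactly one of the
two signs. -/
theorem moveSign_mul_moveSign {a b : V} (h : a ≠ b) {s : Finset V} (ha : a ∉ s) (hb : b ∉ s) :
    moveSign k b s * moveSign k a (insert b s) = -(moveSign k a s * moveSign k b (insert a s)) := by
  rcases lt_or_gt_of_ne h with h | h
  · rw [moveSign_insert_of_gt k h, moveSign_insert_of_lt k h ha]; ring
  · rw [moveSign_insert_of_gt k h, moveSign_insert_of_lt k h hb]; ring

/-- Both products vanish unless `a` and `b` are adjacent to each other and to all of the clique;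
then both orders reach the same clique, with opposite signs. -/
theorem extOp_anticomm (a b : V) : extOp k Γ a * extOp k Γ b = -(extOp k Γ b * extOp k Γ a) := by
  by_cases hab : Γ.Adj a b
  · ext s : 2
    have aux : ∀ {a b : V} (hab : Γ.Adj a b) (h : ¬ ∀ u ∈ s.1, Γ.Adj a u),
        extOp k Γ a (extOp k Γ b (Finsupp.single s 1)) = 0 := by
      intro a b hab h
      push Not at h
      obtain ⟨u, hu, hau⟩ := h
      by_cases hb : ∀ u ∈ s.1, Γ.Adj b u
      · simp [extOp_single, extStep_of_adj k Γ hb,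
          extStep_of_not_adj k Γ (s := s.insert b hb) (Finset.mem_insert_of_mem hu) hau]
      · push Not at hb
        obtain ⟨w, hw, hbw⟩ := hb
        simp [extOp_single, extStep_of_not_adj k Γ hw hbw]
    have aux' : ∀ {a b : V} (hab : Γ.Adj a b) (h : ¬ ∀ u ∈ s.1, Γ.Adj b u),
        extOp k Γ a (extOp k Γ b (Finsupp.single s 1)) = 0 := by
      intro a b hab h
      push Not at h
      obtain ⟨w, hw, hbw⟩ := h
      simp [extOp_single, extStep_of_not_adj k Γ hw hbw]
    by_cases ha : ∀ u ∈ s.1, Γ.Adj a u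
    · by_cases hb : ∀ u ∈ s.1, Γ.Adj b u
      · have ha' : ∀ u ∈ (s.insert b hb).1, Γ.Adj a u := by
          simpa [Clique.insert, hab] using ha
        have hb' : ∀ u ∈ (s.insert a ha).1, Γ.Adj b u := by
          simpa [Clique.insert, hab.symm] using hb
        have hcomm : (s.insert b hb).insert a ha' = (s.insert a ha).insert b hb' :=
          Subtype.ext (Finset.insert_comm _ _ _)
        have has : a ∉ s.1 := fun h => Γ.irrefl (ha a h)
        have hbs : b ∉ s.1 := fun h => Γ.irrefl (hb b h)
        simp only [LinearMap.comp_apply, Module.End.mul_apply, LinearMap.neg_apply, extOp_single,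
          Finsupp.lsingle_apply, extStep_of_adj k Γ ha, extStep_of_adj k Γ hb, one_smul,
          extStep_of_adj k Γ ha', extStep_of_adj k Γ hb', hcomm, Finsupp.smul_single, smul_eq_mul]
        rw [← Finsupp.single_neg]
        exact congrArg _ (moveSign_mul_moveSign k hab.ne has hbs)
      · simp [aux' hab hb, aux hab.symm hb]
    · simp [aux' hab.symm ha, aux hab ha]
  · rw [extOp_mul_of_not_adj k Γ hab, extOp_mul_of_not_adj k Γ (fun h => hab h.symm)]
    exact (neg_zero (G := Module.End k (Clique Γ →₀ k))).symm

/-- The action of `S_Γ` on the free module on the cliques. -/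
def extAction : ExtAlg k Γ →ₐ[k] Module.End k (Clique Γ →₀ k) :=
  RingQuot.liftAlgHom k ⟨FreeAlgebra.lift k (extOp k Γ), by
    rintro _ _ (⟨a⟩ | ⟨a, b⟩ | ⟨a, b, h⟩)
    · simpa using extOp_mul_of_not_adj k Γ (Γ.irrefl (v := a))
    · simpa using extOp_anticomm k Γ a b
    · simpa using extOp_mul_of_not_adj k Γ h⟩

theorem extAction_gen (a : V) : extAction k Γ (extGen k Γ a) = extOp k Γ a :=
  (RingQuot.liftAlgHom_mkAlgHom_apply _ _ _ _).trans (FreeAlgebra.lift_ι_apply _ _)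

/-- The ordered product of the generators attached to a finite set of vertices. -/
def extProd (s : Finset V) : ExtAlg k Γ := ((s.sort (· ≤ ·)).map (extGen k Γ)).prod

theorem extProd_empty : extProd k Γ ∅ = 1 := by simp [extProd]

theorem extProd_insert_of_lt {a : V} {s : Finset V} (h : ∀ u ∈ s, a < u) :
    extProd k Γ (insert a s) = extGen k Γ a * extProd k Γ s := by
  rw [extProd, Finset.sort_insert _ (fun u hu => (h u hu).le) (fun ha => (h a ha).false),
    List.map_cons, List.prod_cons, extProd]

/-- Up to sign, `a` moves past the factors before `u` until the two meet and vanish. -/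
theorem extGen_mul_extProd_of_not_adj {a u : V} (h : ¬ Γ.Adj a u) {s : Finset V} (hu : u ∈ s) :
    extGen k Γ a * extProd k Γ s = 0 := by
  induction s using Finset.induction_on_min with
  | empty => simp at hu
  | insert b s hb ih =>
    rw [extProd_insert_of_lt k Γ hb]
    rcases Finset.mem_insert.1 hu with rfl | hu
    · rw [← mul_assoc, extGen_nonadj k Γ _ _ h, zero_mul]
    · rw [extGen_mul_extGen_mul, ih hu, mul_zero, smul_zero]

/-- Each smaller factor that `a` passes contributes `-1`. No clique condition is involved. -/
theorem extGen_mul_extProd {a : V} {s : Finset V} (ha : a ∉ s) :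
    extGen k Γ a * extProd k Γ s = moveSign k a s • extProd k Γ (insert a s) := by
  induction s using Finset.induction_on_min with
  | empty => simp [moveSign, extProd, Finset.sort_singleton]
  | insert b s hb ih =>
    have hbs : b ∉ s := fun h => (hb b h).false
    rw [Finset.mem_insert, not_or] at ha
    rcases lt_or_gt_of_ne ha.1 with h | h
    · have hlt : ∀ u ∈ insert b s, a < u := by
        simpa [h] using fun u hu => h.trans (hb u hu)
      have : (insert b s).filter (· < a) = ∅ :=
        Finset.filter_eq_empty_iff.2 fun u hu => (hlt u hu).not_gt
      rw [extProd_insert_of_lt k Γ hlt, moveSign, this, Finset.card_empty, pow_zero, one_smul]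
    · rw [moveSign_insert_of_lt k h hbs, Finset.insert_comm, extProd_insert_of_lt k Γ hb,
        extProd_insert_of_lt k Γ (by simpa [h] using hb), extGen_mul_extGen_mul, ih ha.2,
        mul_smul_comm, smul_smul, neg_one_mul]

/-- The largest vertex acts first, so each inserted vertex lies below those present and `moveSign`
is `1`. -/
theorem extAction_extProd (s : Clique Γ) :
    extAction k Γ (extProd k Γ s.1) (Finsupp.single ⟨∅, by simp⟩ 1) = Finsupp.single s 1 := by
  obtain ⟨s, hs⟩ := s
  dsimp only
  induction s using Finset.induction_on_min with
  | empty => simp [extProd_empty]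
  | insert a s ha ih =>
    have has : a ∉ s := fun h => (ha a h).false
    have hs' := hs
    rw [Finset.coe_insert, SimpleGraph.isClique_insert_of_notMem (by simpa using has)] at hs'
    rw [extProd_insert_of_lt k Γ ha, map_mul, Module.End.mul_apply, ih hs'.1, extAction_gen,
      extOp_single, one_smul, extStep_of_adj k Γ (s := ⟨s, hs'.1⟩) hs'.2, moveSign,
      Finset.filter_eq_empty_iff.2 fun u hu => (ha u hu).not_gt, Finset.card_empty, pow_zero]
    rfl

theorem extGrading_free_finrank [Nontrivial k] [Finite V] (n : ℕ) :
    Module.Free k (extGrading k Γ n) ∧ Module.Finite k (extGrading k Γ n) ∧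
      Module.finrank k (extGrading k Γ n) = (Γ.cliqueSet n).ncard := by
  have hcard : (Γ.cliqueSet n).ncard = {s : Clique Γ | s.1.card = n}.ncard := by
    rw [← Set.ncard_image_of_injective _ Subtype.val_injective]
    congr 1
    ext s
    simp [SimpleGraph.isNClique_iff, and_comm]
  rw [hcard]
  refine free_finrank_of_action (extGen k Γ) (adjoin_range_mkAlgHom k _)
    (fun s : Clique Γ => s.1.card) ⟨∅, by simp⟩ Finset.card_empty (extAction k Γ)
    (fun s => extProd k Γ s.1) (extProd_empty k Γ) (fun a s => ?_) (extAction_extProd k Γ)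
    (fun a s => ?_) (fun s => ?_) n (Set.toFinite _)
  · rw [extAction_gen, extOp_single, one_smul]
    by_cases h : ∀ u ∈ s.1, Γ.Adj a u
    · rw [extStep_of_adj k Γ h, Finsupp.linearCombination_single,
        extGen_mul_extProd k Γ fun ha => Γ.irrefl (h a ha)]
      rfl
    · push Not at h
      obtain ⟨u, hu, hau⟩ := h
      rw [extStep_of_not_adj k Γ hu hau, map_zero, extGen_mul_extProd_of_not_adj k Γ hau hu]
  · rw [extAction_gen, extOp_single, one_smul]
    by_cases h : ∀ u ∈ s.1, Γ.Adj a u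
    · rw [extStep_of_adj k Γ h]
      exact Finsupp.single_mem_supported _ _
        (Finset.card_insert_of_notMem fun ha => Γ.irrefl (h a ha))
    · push Not at h
      obtain ⟨u, hu, hau⟩ := h
      rw [extStep_of_not_adj k Γ hu hau]
      exact Submodule.zero_mem _
  · obtain ⟨s, hs⟩ := s
    dsimp only
    -- The degree claim holds for every finite set; without `hs` the induction need not preserve
    -- cliques.
    clear hs
    induction s using Finset.induction_on_min with
    | empty => simp [extProd_empty, Submodule.one_le.1 le_rfl]
    | insert a s ha ih =>
      rw [extProd_insert_of_lt k Γ ha, Finset.card_insert_of_notMem fun h => (ha a h).false,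
        pow_succ']
      exact Submodule.mul_mem_mul (Submodule.subset_span ⟨a, rfl⟩) ih

end ext

/-! ### Reduced traces in signed letters -/

section group
variable {V : Type v} (Γ : SimpleGraph V)

/-- The graph on signed letters: adjacency of the underlying vertices. -/
abbrev signedGraph : SimpleGraph (V × Bool) := Γ.comap Prod.fst

/-- The inverse of a signed letter. -/
def invLetter (a : V × Bool) : V × Bool := (a.1, !a.2)

theorem invLetter_invLetter (a : V × Bool) : invLetter (invLetter a) = a := by simp [invLetter]

theorem invLetter_ne (a : V × Bool) : invLetter a ≠ a := by
  simp [invLetter, Prod.ext_iff]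

variable {Γ}

/-- A word is reduced if no letter can be moved next to an inverse letter. -/
def reducedList (Γ : SimpleGraph V) : List (V × Bool) → Prop
  | [] => True
  | a :: l => Trace.pop (invLetter a) (Trace.mk (signedGraph Γ) l) = none ∧ reducedList Γ l

theorem pop_invLetter_cons_of_adj {a b : V × Bool} (h : Γ.Adj a.1 b.1)
    (m : Trace (signedGraph Γ)) :
    Trace.pop (invLetter a) (Trace.cons b m) = (Trace.pop (invLetter a) m).map (Trace.cons b) :=
  Trace.pop_cons_of_adj (Γ := signedGraph Γ) (a := invLetter a) h m

/-- A letter and its inverse are distinct but lie over one vertex, so they are not adjacent and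
cannot be exchanged. -/
theorem pop_invLetter_cons_self (a : V × Bool) (m : Trace (signedGraph Γ)) :
    Trace.pop (invLetter a) (Trace.cons a m) = none :=
  Trace.pop_cons_of_not_adj (invLetter_ne a) (Γ.irrefl (v := a.1)) m

namespace Trace

/-- A trace is reduced if no letter can be moved next to an inverse letter. -/
def Reduced : Trace (signedGraph Γ) → Prop :=
  Quotient.lift (reducedList Γ) fun _ _ h => by
    induction h with
    | refl => rfl
    | cons a h ih => simp only [reducedList, ih, mk_eq h]
    | swap a b l h =>
      have h : Γ.Adj a.1 b.1 := h
      simp only [reducedList, ← cons_mk, pop_invLetter_cons_of_adj h,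
        pop_invLetter_cons_of_adj h.symm, Option.map_eq_none_iff]
      exact propext and_left_comm
    | trans _ _ ih ih' => exact ih.trans ih'

theorem reduced_nil : (nil : Trace (signedGraph Γ)).Reduced := trivial

theorem reduced_cons_iff (a : V × Bool) (m : Trace (signedGraph Γ)) :
    (cons a m).Reduced ↔ pop (invLetter a) m = none ∧ m.Reduced := by
  obtain ⟨l, rfl⟩ := Quotient.exists_rep m
  exact Iff.rfl

/-- Multiplication by a signed letter on the left, followed by free reduction. -/
def act (a : V × Bool) (m : Trace (signedGraph Γ)) : Trace (signedGraph Γ) :=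
  (pop (invLetter a) m).getD (cons a m)

theorem act_of_pop_eq_none {a : V × Bool} {m : Trace (signedGraph Γ)}
    (h : pop (invLetter a) m = none) : act a m = cons a m := by simp [act, h]

theorem act_cons_invLetter (a : V × Bool) (m : Trace (signedGraph Γ)) :
    act a (cons (invLetter a) m) = m := by simp [act, pop_cons_self]

theorem act_invLetter_cons (a : V × Bool) (m : Trace (signedGraph Γ)) :
    act (invLetter a) (cons a m) = m := by
  simpa [invLetter_invLetter] using act_cons_invLetter (invLetter a) m

theorem pop_eq_none_or (a : V × Bool) (m : Trace (signedGraph Γ)) :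
    pop (invLetter a) m = none ∨ ∃ m', m = cons (invLetter a) m' := by
  rcases h : pop (invLetter a) m with _ | m'
  · exact Or.inl rfl
  · exact Or.inr ⟨m', eq_cons_of_pop h⟩

theorem Reduced.act {m : Trace (signedGraph Γ)} (h : m.Reduced) (a : V × Bool) :
    (act a m).Reduced := by
  rcases pop_eq_none_or a m with h' | ⟨m', rfl⟩
  · rw [act_of_pop_eq_none h', reduced_cons_iff]
    exact ⟨h', h⟩
  · rw [act_cons_invLetter]
    exact ((reduced_cons_iff _ _).1 h).2

/-- Reducedness enters when `a` cancels: the remaining trace then has no first letter `a`, so the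
inverse letter is put back without a new cancellation. -/
theorem act_invLetter_act {m : Trace (signedGraph Γ)} (h : m.Reduced) (a : V × Bool) :
    Trace.act (invLetter a) (Trace.act a m) = m := by
  rcases pop_eq_none_or a m with h' | ⟨m', rfl⟩
  · rw [act_of_pop_eq_none h', act_invLetter_cons]
  · rw [act_cons_invLetter]
    exact act_of_pop_eq_none ((reduced_cons_iff _ _).1 h).1

theorem act_cons_of_adj {a b : V × Bool} (h : Γ.Adj a.1 b.1) (m : Trace (signedGraph Γ)) :
    Trace.act a (cons b m) = cons b (Trace.act a m) := by
  rcases pop_eq_none_or a m with h' | ⟨m', rfl⟩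
  · rw [act_of_pop_eq_none h', act_of_pop_eq_none, cons_comm (Γ := signedGraph Γ) h]
    rw [pop_invLetter_cons_of_adj h, h', Option.map_none]
  · rw [act_cons_invLetter, cons_comm (Γ := signedGraph Γ) (a := b) (b := invLetter a) h.symm,
      act_cons_invLetter]

/-- Adjacent letters prepend or cancel independently of each other; this makes `actPerm` respect the
relators of `A_Γ`. -/
theorem act_comm {a b : V × Bool} (h : Γ.Adj a.1 b.1) (m : Trace (signedGraph Γ)) :
    Trace.act a (Trace.act b m) = Trace.act b (Trace.act a m) := by
  rcases pop_eq_none_or b m with hb | ⟨m', rfl⟩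
  · rcases pop_eq_none_or a m with ha | ⟨m', rfl⟩
    · rw [act_of_pop_eq_none hb, act_of_pop_eq_none ha, act_cons_of_adj h, act_of_pop_eq_none ha,
        act_cons_of_adj h.symm, act_of_pop_eq_none hb, cons_comm (Γ := signedGraph Γ) h]
    · rw [act_cons_invLetter, act_cons_of_adj (b := invLetter a) h.symm, act_cons_invLetter]
  · rw [act_cons_invLetter, act_cons_of_adj (b := invLetter b) h, act_cons_invLetter]

theorem length_act_le (a : V × Bool) (m : Trace (signedGraph Γ)) :
    (Trace.act a m).length ≤ m.length + 1 := by
  rcases pop_eq_none_or a m with h' | ⟨m', rfl⟩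
  · rw [act_of_pop_eq_none h', length_cons]
  · rw [act_cons_invLetter, length_cons]
    omega

end Trace

variable (Γ)

/-- The reduced traces in signed letters. -/
abbrev ReducedTrace : Type v := {m : Trace (signedGraph Γ) // m.Reduced}

/-- The permutation of the reduced traces given by a signed letter. -/
def actPerm (a : V × Bool) : Equiv.Perm (ReducedTrace Γ) where
  toFun m := ⟨Trace.act a m.1, m.2.act a⟩
  invFun m := ⟨Trace.act (invLetter a) m.1, m.2.act _⟩
  left_inv m := Subtype.ext (Trace.act_invLetter_act m.2 a)
  right_inv m := Subtype.ext (by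
    simpa [invLetter_invLetter] using Trace.act_invLetter_act m.2 (invLetter a))

theorem actPerm_invLetter (a : V × Bool) : actPerm Γ (invLetter a) = (actPerm Γ a)⁻¹ :=
  Equiv.ext fun _ => rfl

/-! ### The action of the right angled Artin group on the reduced traces -/

/-- The action of `A_Γ` on the reduced traces. -/
def artinAction : ArtinGroup Γ →* Equiv.Perm (ReducedTrace Γ) :=
  PresentedGroup.toGroup (f := fun a => actPerm Γ (a, true)) (by
    rintro _ ⟨a, b, h, rfl⟩
    simp only [map_mul, map_inv, FreeGroup.lift_apply_of]
    rw [mul_inv_eq_one, mul_inv_eq_iff_eq_mul]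
    ext m
    exact congrArg _ (Subtype.ext (Trace.act_comm (a := (a, true)) (b := (b, true)) h m.1)))

/-- The element of `A_Γ` given by a signed letter. -/
def artinLetter (a : V × Bool) : ArtinGroup Γ :=
  if a.2 then PresentedGroup.of a.1 else (PresentedGroup.of a.1)⁻¹

theorem artinLetter_invLetter (a : V × Bool) :
    artinLetter Γ (invLetter a) = (artinLetter Γ a)⁻¹ := by
  obtain ⟨v, _ | _⟩ := a <;> simp [artinLetter, invLetter]

theorem artinAction_artinLetter (a : V × Bool) :
    artinAction Γ (artinLetter Γ a) = actPerm Γ a := by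
  have h (v : V) : artinAction Γ (PresentedGroup.of v) = actPerm Γ (v, true) :=
    PresentedGroup.toGroup.of _
  obtain ⟨v, _ | _⟩ := a
  · simp [artinLetter, h, ← actPerm_invLetter, invLetter]
  · simp [artinLetter, h]

theorem of_commute {a b : V} (h : Γ.Adj a b) :
    Commute (PresentedGroup.of a : ArtinGroup Γ) (PresentedGroup.of b) := by
  have : PresentedGroup.mk (groupRels Γ) (FreeGroup.of a * FreeGroup.of b * (FreeGroup.of a)⁻¹ *
      (FreeGroup.of b)⁻¹) = 1 := PresentedGroup.one_of_mem ⟨a, b, h, rfl⟩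
  rw [map_mul, map_mul, map_mul, map_inv, map_inv, mul_inv_eq_one, mul_inv_eq_iff_eq_mul] at this
  exact this

theorem artinLetter_comm (a b : V × Bool) (h : (signedGraph Γ).Adj a b) :
    artinLetter Γ a * artinLetter Γ b = artinLetter Γ b * artinLetter Γ a := by
  have h : Commute _ _ := of_commute Γ (a := a.1) (b := b.1) h
  obtain ⟨v, _ | _⟩ := a <;> obtain ⟨w, _ | _⟩ := b <;>
    simp only [artinLetter, Bool.false_eq_true, if_true, if_false]
  exacts [h.inv_inv, h.inv_left, h.inv_right, h]

/-- The element of `A_Γ` represented by a trace. -/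
def traceValue : Trace (signedGraph Γ) → ArtinGroup Γ :=
  Trace.prod (artinLetter Γ) (artinLetter_comm Γ)

theorem traceValue_cons (a : V × Bool) (m : Trace (signedGraph Γ)) :
    traceValue Γ (Trace.cons a m) = artinLetter Γ a * traceValue Γ m := Trace.prod_cons _ _ _ _

theorem traceValue_act (a : V × Bool) (m : Trace (signedGraph Γ)) :
    traceValue Γ (Trace.act a m) = artinLetter Γ a * traceValue Γ m := by
  rcases Trace.pop_eq_none_or a m with h' | ⟨m', rfl⟩
  · rw [Trace.act_of_pop_eq_none h', traceValue_cons]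
  · rw [Trace.act_cons_invLetter, traceValue_cons, artinLetter_invLetter, mul_inv_cancel_left]

/-- The reduced trace representing an element of `A_Γ`. -/
def normalForm (g : ArtinGroup Γ) : ReducedTrace Γ :=
  artinAction Γ g ⟨Trace.nil, Trace.reduced_nil⟩

theorem normalForm_letter_mul (a : V × Bool) (g : ArtinGroup Γ) :
    normalForm Γ (artinLetter Γ a * g) = actPerm Γ a (normalForm Γ g) := by
  rw [normalForm, map_mul, artinAction_artinLetter]
  rfl

theorem normalForm_one : normalForm Γ 1 = ⟨Trace.nil, Trace.reduced_nil⟩ := by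
  simp [normalForm]

theorem exists_artinLetter {x : ArtinGroup Γ} (hx : x ∈ artinGens Γ ∨ x⁻¹ ∈ artinGens Γ) :
    ∃ a, artinLetter Γ a = x := by
  rcases hx with ⟨v, rfl⟩ | ⟨v, hv⟩
  · exact ⟨(v, true), by simp [artinLetter]⟩
  · exact ⟨(v, false), by simp [artinLetter, hv]⟩

theorem artinLetter_mem (a : V × Bool) :
    artinLetter Γ a ∈ artinGens Γ ∨ (artinLetter Γ a)⁻¹ ∈ artinGens Γ := by
  obtain ⟨v, _ | _⟩ := a
  · exact Or.inr ⟨v, by simp [artinLetter]⟩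
  · exact Or.inl ⟨v, by simp [artinLetter]⟩

theorem traceValue_normalForm (g : ArtinGroup Γ) : traceValue Γ (normalForm Γ g).1 = g := by
  have hg : g ∈ Subgroup.closure (artinGens Γ) := closure_artinGens Γ ▸ Subgroup.mem_top g
  induction hg using Subgroup.closure_induction_left with
  | one => rw [normalForm_one]; rfl
  | mul_left x hx y _ ih =>
    obtain ⟨a, rfl⟩ := exists_artinLetter Γ (Or.inl hx)
    rw [normalForm_letter_mul]
    exact (traceValue_act Γ a _).trans (by rw [ih])
  | inv_mul_cancel x hx y _ ih =>
    obtain ⟨a, ha⟩ := exists_artinLetter Γ (x := x⁻¹) (Or.inr (by simpa using hx))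
    rw [← ha, normalForm_letter_mul]
    exact (traceValue_act Γ a _).trans (by rw [ih])

/-- Rebuilding a reduced trace letter by letter never triggers a cancellation. -/
theorem normalForm_traceValue (m : ReducedTrace Γ) : normalForm Γ (traceValue Γ m.1) = m := by
  obtain ⟨m, hm⟩ := m
  dsimp only
  induction m using Trace.ind with
  | nil => exact normalForm_one Γ
  | cons a m ih =>
    have h := (Trace.reduced_cons_iff a m).1 hm
    rw [traceValue_cons, normalForm_letter_mul, ih h.2]
    exact Subtype.ext (Trace.act_of_pop_eq_none h.1)

/-- Elements of `A_Γ` correspond to reduced traces. -/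
def artinEquiv : ArtinGroup Γ ≃ ReducedTrace Γ where
  toFun := normalForm Γ
  invFun m := traceValue Γ m.1
  left_inv := traceValue_normalForm Γ
  right_inv := normalForm_traceValue Γ

/-- A word for the normal form bounds the length from above. From below, each factor lengthens the
normal form by at most one. -/
theorem wordLength_eq (g : ArtinGroup Γ) :
    wordLength (artinGens Γ) g = (normalForm Γ g).1.length := by
  obtain ⟨l, hl⟩ := Quotient.exists_rep (normalForm Γ g).1
  -- This also shows the set is nonempty, so its `sInf` is not the default `0`.
  have hmem : (normalForm Γ g).1.length ∈ {n | ∃ l : List (ArtinGroup Γ),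
      (∀ x ∈ l, x ∈ artinGens Γ ∨ x⁻¹ ∈ artinGens Γ) ∧ l.prod = g ∧ l.length = n} := by
    refine ⟨l.map (artinLetter Γ), ?_, ?_, ?_⟩
    · intro x hx
      obtain ⟨a, _, rfl⟩ := List.mem_map.1 hx
      exact artinLetter_mem Γ a
    · rw [← traceValue_normalForm Γ g, ← hl]
      rfl
    · rw [List.length_map, ← hl]
      rfl
  refine le_antisymm (Nat.sInf_le hmem) (le_csInf ⟨_, hmem⟩ ?_)
  clear hmem hl l
  rintro _ ⟨l, hl, rfl, rfl⟩
  induction l with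
  | nil => rw [List.prod_nil, normalForm_one]; rfl
  | cons x l ih =>
    rw [List.forall_mem_cons] at hl
    obtain ⟨a, rfl⟩ := exists_artinLetter Γ hl.1
    rw [List.prod_cons, normalForm_letter_mul, List.length_cons]
    exact (Trace.length_act_le a _).trans (Nat.succ_le_succ (ih hl.2))

theorem finite_reducedTrace_length [Finite V] (n : ℕ) :
    {m : ReducedTrace Γ | m.1.length = n}.Finite :=
  (Trace.finite_length n).preimage Subtype.val_injective.injOn

theorem wordSphere_eq (n : ℕ) : wordSphere (artinGens Γ) n =
    artinEquiv Γ ⁻¹' {m : ReducedTrace Γ | m.1.length = n} := by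
  ext g
  simp [wordSphere, wordLength_eq, artinEquiv]

theorem finite_wordSphere [Finite V] (n : ℕ) : (wordSphere (artinGens Γ) n).Finite := by
  rw [wordSphere_eq]
  exact (finite_reducedTrace_length Γ n).preimage (artinEquiv Γ).injective.injOn

theorem ncard_wordSphere (n : ℕ) : (wordSphere (artinGens Γ) n).ncard =
    {m : ReducedTrace Γ | m.1.length = n}.ncard := by
  rw [wordSphere_eq, Set.ncard_preimage_of_injective_subset_range (artinEquiv Γ).injective]
  simp [(artinEquiv Γ).surjective.range_eq]

end group

/-! ### Inclusion-exclusion over cliques -/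

/-- The generating series by length of the elements whose set of divisors contains `C`. -/
def divSeries {X : Type u} {V : Type v} (len : X → ℕ) (D : X → Set V) (C : Finset V) : ℚ⟦X⟧ :=
  PowerSeries.mk fun n => ({x | len x = n ∧ (C : Set V) ⊆ D x}.ncard : ℚ)

-- As `D x` is a clique, the cliques inside it are all its subsets, and their alternating sum
-- vanishes unless `D x = ∅`.
open Classical in
theorem sum_clique_divSeries {X : Type u} {V : Type v} [Fintype V] (Γ : SimpleGraph V)
    (len : X → ℕ) (hfin : ∀ n, {x | len x = n}.Finite) (D : X → Set V)
    (hD : ∀ x, Γ.IsClique (D x)) (e : X) (hlen : len e = 0) (he : ∀ x, D x = ∅ ↔ x = e) :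
    ∑ C ∈ Finset.univ.filter fun C : Finset V => Γ.IsClique (C : Set V),
      (-1 : ℚ⟦X⟧) ^ C.card * divSeries len D C = 1 := by
  ext n
  have hcoeff (C : Finset V) : coeff n ((-1 : ℚ⟦X⟧) ^ C.card * divSeries len D C) =
      ∑ x ∈ (hfin n).toFinset, if (C : Set V) ⊆ D x then (-1 : ℚ) ^ C.card else 0 := by
    have h1 : (-1 : ℚ⟦X⟧) ^ C.card = PowerSeries.C ((-1 : ℚ) ^ C.card) := by simp
    have h2 : {x | len x = n ∧ (C : Set V) ⊆ D x} =
        ((hfin n).toFinset.filter fun x => (C : Set V) ⊆ D x : Finset X) := by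
      ext x
      simp
    rw [h1, coeff_C_mul, divSeries, coeff_mk, h2, Set.ncard_coe_finset, ← Finset.sum_filter,
      Finset.sum_const, nsmul_eq_mul, mul_comm]
  have hx (x : X) : ∑ C ∈ Finset.univ.filter fun C : Finset V => Γ.IsClique (C : Set V),
      (if (C : Set V) ⊆ D x then (-1 : ℚ) ^ C.card else 0) = if x = e then 1 else 0 := by
    rw [← Finset.sum_filter, Finset.filter_filter]
    have h1 : (Finset.univ.filter fun C : Finset V =>
        Γ.IsClique (C : Set V) ∧ (C : Set V) ⊆ D x) = (D x).toFinset.powerset := by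
      ext C
      simpa [Set.subset_toFinset] using fun h => (hD x).subset h
    have h2 := Finset.sum_powerset_neg_one_pow_card (x := (D x).toFinset)
    rw [h1]
    have h3 : ((D x).toFinset = ∅) = (x = e) := by
      rw [Set.toFinset_eq_empty, he]
    simp only [h3] at h2
    exact_mod_cast congrArg (Int.cast : ℤ → ℚ) h2
  rw [map_sum, Finset.sum_congr rfl fun C _ => hcoeff C, Finset.sum_comm,
    Finset.sum_congr rfl fun x _ => hx x, Finset.sum_ite_eq', coeff_one]
  simp [hlen, eq_comm]

/-- Building a clique vertex by vertex turns `hq` into a factor `q ^ C.card`, so the alternating sum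
becomes the clique polynomial at `-q`. -/
theorem sum_clique_mul_divSeries {X : Type u} {V : Type v} [Finite V] (Γ : SimpleGraph V)
    (len : X → ℕ) (hfin : ∀ n, {x | len x = n}.Finite) (D : X → Set V)
    (hD : ∀ x, Γ.IsClique (D x)) (e : X) (hlen : len e = 0) (he : ∀ x, D x = ∅ ↔ x = e)
    (q : ℚ⟦X⟧) (hq : ∀ (C : Finset V) (a : V) [DecidableEq V], (∀ u ∈ C, Γ.Adj a u) →
      divSeries len D (insert a C) = q * divSeries len D C) :
    (∑ n ∈ Finset.range (Nat.card V + 1), ((Γ.cliqueSet n).ncard : ℚ) • (-q) ^ n) *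
      divSeries len D ∅ = 1 := by
  classical
  have := Fintype.ofFinite V
  have hpow (C : Finset V) (hC : Γ.IsClique (C : Set V)) :
      divSeries len D C = q ^ C.card * divSeries len D ∅ := by
    induction C using Finset.induction_on with
    | empty => simp
    | insert a C ha ih =>
      rw [Finset.coe_insert, SimpleGraph.isClique_insert_of_notMem (by simpa using ha)] at hC
      rw [hq C a hC.2, ih hC.1, Finset.card_insert_of_notMem ha, pow_succ']
      ring
  rw [← sum_clique_divSeries Γ len hfin D hD e hlen he, Finset.sum_congr
    (s₁ := Finset.univ.filter fun C : Finset V => Γ.IsClique (C : Set V)) rfl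
    fun C hC => by rw [hpow C (Finset.mem_filter.1 hC).2, ← mul_assoc, ← mul_pow, neg_one_mul],
    ← Finset.sum_mul]
  congr 1
  rw [← Finset.sum_fiberwise_of_maps_to (g := Finset.card) (t := Finset.range (Nat.card V + 1))
    fun C _ => Finset.mem_range_succ_iff.2 (by simpa using Finset.card_le_univ C)]
  refine Finset.sum_congr rfl fun n _ => ?_
  have : Γ.cliqueSet n = ((Finset.univ.filter fun C : Finset V => Γ.IsClique (C : Set V)).filter
      fun C => C.card = n : Finset (Finset V)) := by
    ext C
    simp [SimpleGraph.isNClique_iff]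
  rw [this, Set.ncard_coe_finset, Finset.sum_congr rfl fun C hC => by
    rw [(Finset.mem_filter.1 hC).2], Finset.sum_const, Nat.cast_smul_eq_nsmul]

/-! ### The growth of traces -/

section
variable {V : Type v} (Γ : SimpleGraph V)

/-- The possible first letters of a trace. -/
def Trace.first {S : Type v} {Γ : SimpleGraph S} (m : Trace Γ) : Set S := {a | pop a m ≠ none}

theorem Trace.mem_first_cons_of_adj {a b : V} {Γ : SimpleGraph V} (h : Γ.Adj a b) (m : Trace Γ) :
    a ∈ (cons b m).first ↔ a ∈ m.first := pop_cons_ne_none_iff h m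

theorem Trace.mem_first_iff {a : V} {Γ : SimpleGraph V} {m : Trace Γ} :
    a ∈ m.first ↔ ∃ m', cons a m' = m := by
  refine ⟨fun h => ?_, ?_⟩
  · obtain ⟨m', hm'⟩ := Option.ne_none_iff_exists'.1 h
    exact ⟨m', (eq_cons_of_pop hm').symm⟩
  · rintro ⟨m', rfl⟩
    simp [first, pop_cons_self]

theorem Trace.first_nil {Γ : SimpleGraph V} : (nil : Trace Γ).first = ∅ := by
  ext a
  simp [first, pop_nil]

theorem Trace.first_eq_empty_iff {Γ : SimpleGraph V} {m : Trace Γ} : m.first = ∅ ↔ m = nil := by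
  refine ⟨fun h => eq_nil_of_pop fun a => ?_, ?_⟩
  · by_contra ha
    exact (h ▸ ha : a ∈ (∅ : Set V))
  · rintro rfl
    exact first_nil

/-- Here `q = X`: if `a` is adjacent to all of `C`, prepending `a` preserves whether `C` consists of
first letters and raises the length by one. -/
theorem sum_clique_mul_trace [Finite V] :
    (∑ n ∈ Finset.range (Nat.card V + 1), ((Γ.cliqueSet n).ncard : ℚ) • (-X : ℚ⟦X⟧) ^ n) *
      PowerSeries.mk (fun n => ({m : Trace Γ | m.length = n}.ncard : ℚ)) = 1 := by
  have h := sum_clique_mul_divSeries Γ (Trace.length (Γ := Γ)) Trace.finite_length Trace.first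
    (fun m a ha b hb hab => Trace.adj_of_pop hab ha hb) Trace.nil Trace.length_nil
    (fun m => Trace.first_eq_empty_iff) X fun C a _ hC => ?_
  · simpa [divSeries] using h
  ext n
  rcases n with _ | n
  · have : {m : Trace Γ | m.length = 0 ∧ ((insert a C : Finset V) : Set V) ⊆ m.first} = ∅ := by
      rw [Set.eq_empty_iff_forall_notMem]
      rintro m ⟨hm, hC⟩
      obtain ⟨m', rfl⟩ := Trace.mem_first_iff.1 (hC (Finset.mem_insert_self a C))
      simp [Trace.length_cons] at hm
    rw [divSeries, coeff_mk, this]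
    simp
  · rw [mul_comm, coeff_succ_mul_X, divSeries, divSeries, coeff_mk, coeff_mk,
      ← Set.ncard_image_of_injective {m : Trace Γ | m.length = n ∧ (C : Set V) ⊆ m.first}
        (Trace.cons_injective a)]
    congr 2
    ext m
    have key (m : Trace Γ) : (C : Set V) ⊆ (Trace.cons a m).first ↔ (C : Set V) ⊆ m.first :=
      forall₂_congr fun u hu => Trace.mem_first_cons_of_adj (hC u hu).symm m
    constructor
    · rintro ⟨hm, h⟩
      rw [Finset.coe_insert, Set.insert_subset_iff] at h
      obtain ⟨m', rfl⟩ := Trace.mem_first_iff.1 h.1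
      exact ⟨m', ⟨by simpa [Trace.length_cons] using hm, (key m').1 h.2⟩, rfl⟩
    · rintro ⟨m, ⟨hm, h⟩, rfl⟩
      refine ⟨by rw [Trace.length_cons, hm], ?_⟩
      rw [Finset.coe_insert, Set.insert_subset_iff]
      exact ⟨Trace.mem_first_iff.2 ⟨m, rfl⟩, (key m).2 h⟩

/-! ### The growth of reduced traces -/

variable {Γ} in
/-- The vertices underlying the possible first letters of a reduced trace. -/
def ReducedTrace.first (m : ReducedTrace Γ) : Set V := Prod.fst '' m.1.first

variable {Γ} in
theorem ReducedTrace.mem_first_iff {m : ReducedTrace Γ} {v : V} :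
    v ∈ m.first ↔ (v, true) ∈ m.1.first ∨ (v, false) ∈ m.1.first := by
  simp [ReducedTrace.first, or_comm]

variable {Γ} in
theorem Trace.notMem_first_of_mem {m : Trace (signedGraph Γ)} {a : V × Bool} (h : a ∈ m.first) :
    invLetter a ∉ m.first := by
  obtain ⟨m, rfl⟩ := mem_first_iff.1 h
  exact fun h => h (pop_invLetter_cons_self a m)

/-- The reduced traces of length `n` such that all members of `C` underlie possible first
letters. -/
def divSet (C : Set V) (n : ℕ) : Set (ReducedTrace Γ) := {m | m.1.length = n ∧ C ⊆ m.first}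

/-- Prepending `a` maps the members of length `n` without first letter `a⁻¹` bijectively to those of
length `n + 1` with first letter `a`. -/
theorem ncard_divSet_inter_add [Finite V] {C : Set V} {a : V × Bool} (hC : ∀ u ∈ C, Γ.Adj a.1 u)
    (n : ℕ) :
    (divSet Γ C (n + 1) ∩ {m | a ∈ m.1.first}).ncard +
      (divSet Γ C n ∩ {m | invLetter a ∈ m.1.first}).ncard = (divSet Γ C n).ncard := by
  have hfin : (divSet Γ C n).Finite := (finite_reducedTrace_length Γ n).subset fun m h => h.1
  rw [← Set.ncard_inter_add_ncard_sdiff_eq_ncard (divSet Γ C n) {m | invLetter a ∈ m.1.first} hfin,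
    add_comm, add_right_inj, ← Set.ncard_image_of_injective (divSet Γ C n \ _)
      (actPerm Γ a).injective]
  congr 1
  have key (m : Trace (signedGraph Γ)) (hm : m.Reduced) (hm' : (Trace.cons a m).Reduced) :
      C ⊆ ReducedTrace.first ⟨Trace.cons a m, hm'⟩ ↔ C ⊆ ReducedTrace.first ⟨m, hm⟩ := by
    refine forall₂_congr fun u hu => ?_
    rw [ReducedTrace.mem_first_iff, ReducedTrace.mem_first_iff]
    exact or_congr
      (Trace.mem_first_cons_of_adj (Γ := signedGraph Γ) (a := (u, true)) (hC u hu).symm m)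
      (Trace.mem_first_cons_of_adj (Γ := signedGraph Γ) (a := (u, false)) (hC u hu).symm m)
  ext ⟨m, hm⟩
  constructor
  · rintro ⟨⟨hlen, h⟩, ha⟩
    obtain ⟨m, rfl⟩ := Trace.mem_first_iff.1 ha
    have hred := (Trace.reduced_cons_iff a m).1 hm
    refine ⟨⟨m, hred.2⟩, ⟨⟨by simpa [Trace.length_cons] using hlen, (key m hred.2 hm).1 h⟩,
      fun h => h hred.1⟩, Subtype.ext (Trace.act_of_pop_eq_none hred.1)⟩
  · rintro ⟨⟨m', hm'⟩, ⟨⟨hlen, h⟩, ha⟩, heq⟩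
    have ha : Trace.pop (invLetter a) m' = none := not_not.1 ha
    obtain rfl : Trace.cons a m' = m :=
      (Trace.act_of_pop_eq_none ha).symm.trans (congrArg Subtype.val heq)
    exact ⟨⟨(Trace.length_cons a m').trans (congrArg _ hlen), (key m' hm' hm).2 h⟩,
      Trace.mem_first_iff.2 ⟨m', rfl⟩⟩

/-- A letter and its inverse are never both first letters, so the two cases are disjoint. -/
theorem ncard_divSet_insert [Finite V] (C : Set V) (v : V) (n : ℕ) :
    (divSet Γ (insert v C) n).ncard = (divSet Γ C n ∩ {m | (v, true) ∈ m.1.first}).ncard +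
      (divSet Γ C n ∩ {m | (v, false) ∈ m.1.first}).ncard := by
  have hfin : (divSet Γ C n).Finite := (finite_reducedTrace_length Γ n).subset fun m h => h.1
  rw [← Set.ncard_union_eq _ (hfin.subset Set.inter_subset_left)
    (hfin.subset Set.inter_subset_left)]
  · congr 1
    ext m
    simp only [divSet, Set.insert_subset_iff, ReducedTrace.mem_first_iff, Set.mem_ofPred_eq,
      Set.mem_union, Set.mem_inter_iff]
    tauto
  · rw [Set.disjoint_left]
    rintro m ⟨_, h⟩ ⟨_, h'⟩
    exact Trace.notMem_first_of_mem h h'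

/-- Adding `ncard_divSet_inter_add` for both signs of `v` regroups the terms into the two counts on
the left. -/
theorem ncard_divSet_insert_add [Finite V] {C : Set V} {v : V} (hC : ∀ u ∈ C, Γ.Adj v u) (n : ℕ) :
    (divSet Γ (insert v C) (n + 1)).ncard + (divSet Γ (insert v C) n).ncard =
      2 * (divSet Γ C n).ncard := by
  have h1 := ncard_divSet_inter_add Γ (a := (v, true)) hC n
  have h2 := ncard_divSet_inter_add Γ (a := (v, false)) hC n
  simp only [invLetter, Bool.not_true, Bool.not_false] at h1 h2
  rw [ncard_divSet_insert, ncard_divSet_insert]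
  omega

theorem one_add_X_mul_inv : (1 + X : ℚ⟦X⟧) * (1 + X)⁻¹ = 1 :=
  PowerSeries.mul_inv_cancel _ (by simp)

theorem sum_clique_mul_reducedTrace [Finite V] :
    (∑ n ∈ Finset.range (Nat.card V + 1),
      ((Γ.cliqueSet n).ncard : ℚ) • (-(2 * X * (1 + X)⁻¹) : ℚ⟦X⟧) ^ n) *
      PowerSeries.mk (fun n => ({m : ReducedTrace Γ | m.1.length = n}.ncard : ℚ)) = 1 := by
  have h := sum_clique_mul_divSeries Γ (fun m : ReducedTrace Γ => m.1.length)
    (finite_reducedTrace_length Γ) ReducedTrace.first ?_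
    ⟨Trace.nil, Trace.reduced_nil⟩ Trace.length_nil ?_ (2 * X * (1 + X)⁻¹) fun C v _ hC => ?_
  · simpa [divSeries] using h
  · rintro m _ ⟨a, ha, rfl⟩ _ ⟨b, hb, rfl⟩ hab
    exact Trace.adj_of_pop (Γ := signedGraph Γ) (fun h => hab (congrArg _ h)) ha hb
  · intro m
    rw [ReducedTrace.first, Set.image_eq_empty, Trace.first_eq_empty_iff, Subtype.ext_iff]
  -- The recurrence `ncard_divSet_insert_add` as an identity of series; in degree `0` the empty
  -- trace has no first letter.
  have key : (1 + X : ℚ⟦X⟧) * divSeries (fun m : ReducedTrace Γ => m.1.length) ReducedTrace.first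
      (insert v C) = 2 * X *
        divSeries (fun m : ReducedTrace Γ => m.1.length) ReducedTrace.first C := by
    have hs (C : Finset V) (n : ℕ) : coeff n (divSeries (fun m : ReducedTrace Γ => m.1.length)
        ReducedTrace.first C) = ((divSet Γ (C : Set V) n).ncard : ℚ) := coeff_mk _ _
    ext n
    rw [add_mul, one_mul, map_add, mul_assoc, mul_comm 2, mul_assoc]
    rcases n with _ | n
    · have : divSet Γ ((insert v C : Finset V) : Set V) 0 = ∅ := by
        rw [Set.eq_empty_iff_forall_notMem]
        rintro m ⟨hm, hC⟩
        obtain ⟨a, ha, -⟩ := hC (Finset.mem_insert_self v C)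
        obtain ⟨m', h⟩ := Trace.mem_first_iff.1 ha
        simp [← h, Trace.length_cons] at hm
      rw [hs, this]
      simp
    · rw [coeff_succ_X_mul, coeff_succ_X_mul, mul_comm,
        show (2 : ℚ⟦X⟧) = PowerSeries.C 2 from (map_ofNat _ 2).symm, coeff_C_mul, hs, hs, hs,
        Finset.coe_insert]
      exact_mod_cast ncard_divSet_insert_add Γ hC n
  calc _ = (1 + X : ℚ⟦X⟧) * (1 + X)⁻¹ * divSeries (fun m : ReducedTrace Γ => m.1.length)
        ReducedTrace.first (insert v C) := by rw [one_add_X_mul_inv, one_mul]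
    _ = _ := by rw [mul_right_comm, key]; ring

end

end RAAG

end

/-! ### The main theorem -/

open PowerSeries in
theorem theorem1p5 {k : Type*} {V : Type*} [CommRing k] [Nontrivial k] [Finite V]
    (Γ : SimpleGraph V) :
    -- the series are defined: graded pieces are finitely generated free, spheres are finite
    (∀ n, Module.Free k (RAAG.extGrading k Γ n) ∧ Module.Finite k (RAAG.extGrading k Γ n)) ∧
    (∀ n, Module.Free k (RAAG.polyGrading k Γ n) ∧ Module.Finite k (RAAG.polyGrading k Γ n)) ∧
    (∀ n, (RAAG.wordSphere (RAAG.artinGens Γ) n).Finite) ∧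
    -- the Poincare series of `S_Γ`
    RAAG.poincareSeries (RAAG.extGrading k Γ) =
      ∑ n ∈ Finset.range (Nat.card V + 1), ((Γ.cliqueSet n).ncard : ℚ) • (X : ℚ⟦X⟧) ^ n ∧
    -- the relation between the Poincare series of `R_Γ` and `S_Γ`
    RAAG.poincareSeries (RAAG.polyGrading k Γ) *
      (RAAG.poincareSeries (RAAG.extGrading k Γ)).subst (-X : ℚ⟦X⟧) = 1 ∧
    -- the growth series of `A_Γ`
    RAAG.growthSeries (RAAG.artinGens Γ) =
      (RAAG.poincareSeries (RAAG.polyGrading k Γ)).subst (2 * X * (1 + X)⁻¹ : ℚ⟦X⟧) := by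
  -- An arbitrary order: it only fixes the ordered products and signs in the basis of `S_Γ`.
  let _ : LinearOrder V := IsWellOrder.linearOrder WellOrderingRel
  have hext (n : ℕ) := RAAG.extGrading_free_finrank k Γ n
  have hpoly (n : ℕ) := RAAG.polyGrading_free_finrank k Γ n
  have hS : RAAG.poincareSeries (RAAG.extGrading k Γ) =
      ∑ n ∈ Finset.range (Nat.card V + 1), ((Γ.cliqueSet n).ncard : ℚ) • (X : ℚ⟦X⟧) ^ n := by
    ext n
    simp only [RAAG.poincareSeries, coeff_mk, (hext n).2.2, map_sum, coeff_smul, coeff_X_pow,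
      smul_eq_mul, mul_ite, mul_one, mul_zero, Finset.sum_ite_eq, Finset.mem_range]
    split_ifs with h
    · rfl
    · have : Γ.cliqueSet n = ∅ := by
        have := Fintype.ofFinite V
        rw [Set.eq_empty_iff_forall_notMem]
        intro s hs
        have h1 := Finset.card_le_univ s
        rw [((SimpleGraph.mem_cliqueSet_iff).1 hs).card_eq, ← Nat.card_eq_fintype_card] at h1
        omega
      rw [this, Set.ncard_empty, Nat.cast_zero]
  have hR : RAAG.poincareSeries (RAAG.polyGrading k Γ) =
      PowerSeries.mk fun n => ({m : RAAG.Trace Γ | m.length = n}.ncard : ℚ) := by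
    simp only [RAAG.poincareSeries, (hpoly _).2.2]
  have hA : RAAG.growthSeries (RAAG.artinGens Γ) =
      PowerSeries.mk fun n => ({m : RAAG.ReducedTrace Γ | m.1.length = n}.ncard : ℚ) := by
    simp only [RAAG.growthSeries, RAAG.ncard_wordSphere]
  have hX : HasSubst (-X : ℚ⟦X⟧) := HasSubst.of_constantCoeff_zero' (by simp)
  have hq : HasSubst (2 * X * (1 + X)⁻¹ : ℚ⟦X⟧) := HasSubst.of_constantCoeff_zero' (by simp)
  have hRS := RAAG.sum_clique_mul_trace Γ
  refine ⟨fun n => ⟨(hext n).1, (hext n).2.1⟩, fun n => ⟨(hpoly n).1, (hpoly n).2.1⟩,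
    RAAG.finite_wordSphere Γ, hS, ?_, ?_⟩
  · rw [hS, hR, mul_comm, ← coe_substAlgHom hX]
    simpa [substAlgHom_X] using hRS
  · rw [← hR] at hRS
    have h1 := congrArg (substAlgHom hq) hRS
    have h2 := RAAG.sum_clique_mul_reducedTrace Γ
    rw [← hA] at h2
    rw [map_mul, map_one, map_sum] at h1
    simp only [map_smul, map_pow, map_neg, substAlgHom_X, coe_substAlgHom] at h1
    -- Both products equal `1` and share the clique polynomial at `-2t/(1+t)`, which is therefore
    -- nonzero and cancels.
    exact mul_left_cancel₀ (left_ne_zero_of_mul_eq_one h2) (h2.trans h1.symm)
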